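/- Let $m\in\mathbb Z$ and $z\in\mathbb C\setminus(-\infty,0]$. Write $J_\mu(z)=(z/2)^\mu\sum_{k\ge 0}\frac{(-1)^k(z/2)^{2k}}{k!\,\Gamma(\mu+k+1)}$ (principal power) for the Bessel function of the first kind, $Y_\mu(z)=\frac{J_\mu(z)\cos\mu\pi-J_{-\mu}(z)}{\sin\mu\pi}$ for $\mu\notin\mathbb Z$ (and its limit in $\mu$ for $\mu\in\mathbb Z$) for the Bessel function of the second kind, $y_m(z)=\sqrt{\pi/(2z)}\,Y_{m+1/2}(z)$ (principal root) for the spherical Bessel function of the second kind, and $F(w)=e^{-w^2}\int_0^w e^{t^2}\,dt$ for Dawson's integral. Then $$y_m(z)=\sqrt{\frac{2i}{z}}\;e^{iz}\,i^m\left[-\frac1\pi\int_0^\pi F\!\left(-i\sqrt{-2iz}\,\cos(\theta/2)\right)\cos\!\left((m+\tfrac12)\theta\right)d\theta+i(-1)^m\sum_{j=0}^{m}\frac{(2m-j)!}{j!\,(m-j)!}\,(-2iz)^{\,j-m-\frac12}\right],$$ where the sum is empty (equal to $0$) if $m<0$. The roots and powers on the right-hand side are to be read in either of the following two ways, and the formula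 holds in both: (a) if $z$ is not on the negative imaginary axis $\{-it:t>0\}$ (the common cut of the principal values of $\sqrt{2i/z}$ and $\sqrt{-2iz}$), all of them are principal values; (b) for every $z\in\mathbb C\setminus(-\infty,0]$, $\sqrt{-2iz}$ is either of the two complex numbers $s$ with $s^2=-2iz$, and correspondingly $\sqrt{2i/z}=2/s$ and $(-2iz)^{j-m-\frac12}=s^{2j-2m-1}$. -/

import Mathlib

noncomputable section

/-- The Bessel function of the first kind, `J_μ(z) = (z/2)^μ ∑ (-1)^k (z/2)^(2k) / (k! Γ(μ+k+1))`,
with the principal power. (`Complex.Gamma` vanishes at its poles in Mathlib, so that there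
`1/Γ` takes its conventional value `0`.) -/
def besselJ (μ z : ℂ) : ℂ :=
  (z / 2) ^ μ *
    ∑' k : ℕ, (-1 : ℂ) ^ k * (z / 2) ^ (2 * k) / ((k.factorial : ℂ) * Complex.Gamma (μ + k + 1))

/-- The quotient that defines `Y_μ(z)` for `μ` not an integer. -/
def besselYQuotient (μ z : ℂ) : ℂ :=
  (besselJ μ z * Complex.cos (μ * Real.pi) - besselJ (-μ) z) / Complex.sin (μ * Real.pi)

open Classical in
/-- The Bessel function of the second kind `Y_μ(z)`; at integer order it is the limit in the
order of the values at the nearby (non-integer) orders. -/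
def besselY (μ z : ℂ) : ℂ :=
  if ∃ n : ℤ, μ = n then Filter.limUnder (nhdsWithin μ {μ}ᶜ) (fun ν => besselYQuotient ν z)
  else besselYQuotient μ z

/-- The spherical Bessel function of the second kind, `y_m(z) = √(π/(2z)) Y_{m+1/2}(z)`,
with the principal square root. -/
def sphericalBesselY (m : ℤ) (z : ℂ) : ℂ :=
  Complex.sqrt (Real.pi / (2 * z)) * besselY (m + 1 / 2) z

/-- Dawson's integral `F(z) = e^{-z²} ∫_0^z e^{t²} dt`; the path of integration is the segment
`t = r z`, `0 ≤ r ≤ 1`. -/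
def dawson (z : ℂ) : ℂ :=
  Complex.exp (-z ^ 2) * ∫ r in (0 : ℝ)..1, Complex.exp ((r * z) ^ 2) * z

end

/-! The functions y_m satisfy y_{m-1} + y_{m+1} = (2m+1)/z · y_m for all integers m, so they are
determined by y_0 = -cos z/z and y_{-1} = sin z/z. The proof checks that the right-hand side has the
same recurrence and the same two values.

The integrals D_m(a) of F(a cos(θ/2)) cos((m+1/2)θ) satisfy an inhomogeneous three-term recurrence
(`dawsonCoeff_recurrence`), because F' = 1 - 2wF. Its source term is nonzero only at m = 0 and m =
-1. These are also the only indices where the finite sum, cut off at negative m, violates its own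
recurrence (`besselPolySum_recurrence`); in the bracket the two defects cancel. The starting values
come from the closed form of D_0 (`mul_dawsonCoeff_zero`).

On the Bessel side, Y_{m+1/2} is J_{-m-1/2} up to sign, and the recurrence holds term by term in its
series. -/

noncomputable section

/-! ### Dawson's integral and its differential equation -/

/-- Differentiation under the integral sign over a compact interval, for a jointly continuous
derivative. -/
theorem hasDerivAt_intervalIntegral_of_continuous {f f' : ℂ → ℝ → ℂ} (a b : ℝ)
    (hf' : Continuous (Function.uncurry f')) (hf : ∀ x, Continuous (f x))
    (h : ∀ x t, HasDerivAt (fun y => f y t) (f' x t) x) (x₀ : ℂ) :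
    HasDerivAt (fun x => ∫ t in a..b, f x t) (∫ t in a..b, f' x₀ t) x₀ := by
  obtain ⟨C, hC⟩ := ((isCompact_closedBall x₀ 1).prod (isCompact_uIcc (a := a) (b := b))).exists_bound_of_continuousOn
    hf'.continuousOn
  refine (intervalIntegral.hasDerivAt_integral_of_dominated_loc_of_deriv_le
    (F := f) (F' := f') (bound := fun _ => C) (s := Metric.closedBall x₀ 1)
    (Metric.closedBall_mem_nhds x₀ one_pos) ?_ ?_ ?_ ?_ ?_ ?_).2
  · exact Filter.Eventually.of_forall fun x => (hf x).aestronglyMeasurable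
  · exact (hf x₀).intervalIntegrable _ _
  · exact (hf'.comp (Continuous.prodMk_right x₀)).aestronglyMeasurable
  · exact Filter.Eventually.of_forall fun t ht x hx => hC (x, t) ⟨hx, Set.uIoc_subset_uIcc ht⟩
  · exact intervalIntegrable_const
  · exact Filter.Eventually.of_forall fun t _ x _ => h x t

theorem hasDerivAt_integral_exp_sq (w : ℂ) :
    HasDerivAt (fun w : ℂ => ∫ r in (0 : ℝ)..1, Complex.exp ((r * w) ^ 2) * w)
      (Complex.exp (w ^ 2)) w := by
  have h := hasDerivAt_intervalIntegral_of_continuous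
    (f := fun w r => Complex.exp ((r * w) ^ 2) * w)
    (f' := fun w r => (1 + 2 * (r * w) ^ 2) * Complex.exp ((r * w) ^ 2)) 0 1
    (by fun_prop) (fun x => by fun_prop) (fun x t => by
      have h1 : HasDerivAt (fun y : ℂ => ((t : ℂ) * y) ^ 2) (2 * ((t : ℂ) * x) * t) x := by
        refine (((hasDerivAt_id' x).const_mul (t : ℂ)).fun_pow 2).congr_deriv ?_
        simp
      refine (h1.cexp.fun_mul (hasDerivAt_id' x)).congr_deriv ?_
      ring) w
  refine h.congr_deriv ?_
  -- The w-derivative of the integrand is the exact r-derivative of r e^{(rw)²}, so it integrates to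
  -- e^{w²}.
  have hd : ∀ r ∈ Set.uIcc (0 : ℝ) 1, HasDerivAt (fun r : ℝ => (r : ℂ) * Complex.exp ((r * w) ^ 2))
      ((1 + 2 * (r * w) ^ 2) * Complex.exp ((r * w) ^ 2)) r := fun r _ => by
    have h1 : HasDerivAt (fun x : ℂ => (x * w) ^ 2) (2 * ((r : ℂ) * w) * w) r := by
      refine (((hasDerivAt_id' (r : ℂ)).mul_const w).fun_pow 2).congr_deriv ?_
      simp
    refine (((hasDerivAt_id' (r : ℂ)).fun_mul h1.cexp).congr_deriv ?_).comp_ofReal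
    ring
  rw [intervalIntegral.integral_eq_sub_of_hasDerivAt hd
    (Continuous.intervalIntegrable (by fun_prop) _ _)]
  simp

theorem hasDerivAt_dawson (w : ℂ) : HasDerivAt dawson (1 - 2 * w * dawson w) w := by
  have h1 : HasDerivAt (fun w : ℂ => -w ^ 2) (-(2 * w)) w := by
    refine ((hasDerivAt_id' w).fun_pow 2).fun_neg.congr_deriv ?_
    simp
  refine (h1.cexp.fun_mul (hasDerivAt_integral_exp_sq w)).congr_deriv ?_
  rw [← Complex.exp_add]
  simp [dawson]
  ring

@[fun_prop]
theorem continuous_dawson : Continuous dawson :=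
  continuous_iff_continuousAt.2 fun w => (hasDerivAt_dawson w).continuousAt

theorem dawson_zero : dawson 0 = 0 := by simp [dawson]

/-! ### Fourier-type coefficients of Dawson's integral -/

/-- The Fourier-type coefficients `∫_0^π F(a cos(θ/2)) cos((m+1/2)θ) dθ` of Dawson's integral. -/
def dawsonCoeff (m : ℤ) (a : ℂ) : ℂ :=
  ∫ θ in (0 : ℝ)..Real.pi, dawson (a * Complex.cos (θ / 2)) * Complex.cos (((m : ℂ) + 1 / 2) * θ)

/-- The trigonometric integral `∫_0^π sin(θ/2) sin((m+1/2)θ) dθ`. -/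
def sinHalfIntegral (m : ℤ) : ℂ :=
  ∫ θ in (0 : ℝ)..Real.pi, Complex.sin (θ / 2) * Complex.sin (((m : ℂ) + 1 / 2) * θ)

theorem integral_cos_int_mul (k : ℤ) :
    ∫ θ in (0 : ℝ)..Real.pi, Complex.cos ((k : ℂ) * θ) = if k = 0 then (Real.pi : ℂ) else 0 := by
  split_ifs with h
  · simp [h]
  · rw [integral_cos_mul_complex (by exact_mod_cast h)]
    simp [Complex.sin_int_mul_pi]

theorem sinHalfIntegral_eq (m : ℤ) :
    sinHalfIntegral m =
      ((if m = 0 then (Real.pi : ℂ) else 0) - (if m + 1 = 0 then (Real.pi : ℂ) else 0)) / 2 := by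
  rw [← integral_cos_int_mul, ← integral_cos_int_mul, ← intervalIntegral.integral_sub
    (Continuous.intervalIntegrable (by fun_prop) _ _)
    (Continuous.intervalIntegrable (by fun_prop) _ _), ← intervalIntegral.integral_div]
  refine intervalIntegral.integral_congr fun θ _ => ?_
  have e1 : (m : ℂ) * θ = ((m : ℂ) + 1 / 2) * θ - θ / 2 := by ring
  have e2 : ((m + 1 : ℤ) : ℂ) * θ = ((m : ℂ) + 1 / 2) * θ + θ / 2 := by push_cast; ring
  simp only [e1, e2, Complex.cos_sub, Complex.cos_add]
  ring

/-- Integrate the θ-derivative of F(a cos(θ/2)) sin((m+1/2)θ) over [0, π]. The boundary terms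
vanish: F(0) = 0 at θ = π and sin 0 = 0 at θ = 0. Product formulas turn what F' = 1 - 2wF produces
into the neighbours m ± 1. -/
theorem dawsonCoeff_recurrence (m : ℤ) (a : ℂ) :
    a ^ 2 * (dawsonCoeff (m + 1) a - dawsonCoeff (m - 1) a) =
      (4 * m + 2) * dawsonCoeff m a - 2 * a * sinHalfIntegral m := by
  have hd : ∀ θ ∈ Set.uIcc (0 : ℝ) Real.pi,
      HasDerivAt (fun θ : ℝ => dawson (a * Complex.cos (θ / 2)) *
          Complex.sin (((m : ℂ) + 1 / 2) * θ))
        ((1 - 2 * (a * Complex.cos (θ / 2)) * dawson (a * Complex.cos (θ / 2))) *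
          (a * (-Complex.sin (θ / 2) * (1 / 2))) * Complex.sin (((m : ℂ) + 1 / 2) * θ) +
        dawson (a * Complex.cos (θ / 2)) *
          (Complex.cos (((m : ℂ) + 1 / 2) * θ) * ((m : ℂ) + 1 / 2))) θ := fun θ _ => by
    have h0 := hasDerivAt_id' (θ : ℂ)
    have h1 : HasDerivAt (fun r : ℂ => r / 2) (1 / 2) (θ : ℂ) := h0.div_const 2
    have h2 : HasDerivAt (fun r : ℂ => ((m : ℂ) + 1 / 2) * r) ((m : ℂ) + 1 / 2) (θ : ℂ) := by
      simpa using h0.const_mul ((m : ℂ) + 1 / 2)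
    have h3 : HasDerivAt (fun r : ℂ => dawson (a * Complex.cos (r / 2))) _ (θ : ℂ) :=
      (hasDerivAt_dawson _).comp (θ : ℂ) (h1.ccos.const_mul a)
    exact (h3.fun_mul h2.csin).comp_ofReal
  have key := intervalIntegral.integral_eq_sub_of_hasDerivAt hd
    (Continuous.intervalIntegrable (by fun_prop) _ _)
  have hb : Complex.cos ((Real.pi : ℂ) / 2) = 0 := Complex.cos_pi_div_two
  simp only [hb, mul_zero, dawson_zero, zero_mul, Complex.ofReal_zero, Complex.sin_zero,
    sub_zero] at key
  have hlin : a ^ 2 * (dawsonCoeff (m + 1) a - dawsonCoeff (m - 1) a) -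
      ((4 * m + 2) * dawsonCoeff m a - 2 * a * sinHalfIntegral m) = -4 * 0 := by
    rw [← key]
    simp only [dawsonCoeff, sinHalfIntegral, ← intervalIntegral.integral_const_mul]
    rw [← intervalIntegral.integral_sub, ← intervalIntegral.integral_const_mul,
      ← intervalIntegral.integral_sub, ← intervalIntegral.integral_sub]
    · refine intervalIntegral.integral_congr fun θ _ => ?_
      have e1 : (((m + 1 : ℤ) : ℂ) + 1 / 2) * θ = ((m : ℂ) + 1 / 2) * θ + 2 * (θ / 2) := by
        push_cast; ring
      have e2 : (((m - 1 : ℤ) : ℂ) + 1 / 2) * θ = ((m : ℂ) + 1 / 2) * θ - 2 * (θ / 2) := by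
        push_cast; ring
      simp only [e1, e2, Complex.cos_sub, Complex.cos_add, Complex.sin_two_mul]
      ring
    all_goals exact Continuous.intervalIntegrable (by fun_prop) _ _
  linear_combination hlin

theorem dawsonCoeff_neg_one (a : ℂ) : dawsonCoeff (-1) a = dawsonCoeff 0 a := by
  refine intervalIntegral.integral_congr fun θ _ => ?_
  have e : (((-1 : ℤ) : ℂ) + 1 / 2) * θ = -((((0 : ℤ) : ℂ) + 1 / 2) * θ) := by push_cast; ring
  simp only [e, Complex.cos_neg]

theorem integral_cos_half_sq :
    ∫ θ in (0 : ℝ)..Real.pi, Complex.cos ((θ : ℂ) / 2) ^ 2 = Real.pi / 2 := by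
  have h : (∫ θ in (0 : ℝ)..Real.pi, Complex.cos ((θ : ℂ) / 2) ^ 2) =
      ∫ θ in (0 : ℝ)..Real.pi,
        (Complex.cos (((0 : ℤ) : ℂ) * θ) + Complex.cos (((1 : ℤ) : ℂ) * θ)) / 2 := by
    refine intervalIntegral.integral_congr fun θ _ => ?_
    have e : ((1 : ℤ) : ℂ) * θ = 2 * (θ / 2) := by push_cast; ring
    simp only [e, Complex.cos_two_mul]
    simp
  rw [h, intervalIntegral.integral_div, intervalIntegral.integral_add
    (Continuous.intervalIntegrable (by fun_prop) _ _)
    (Continuous.intervalIntegrable (by fun_prop) _ _), integral_cos_int_mul, integral_cos_int_mul]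
  simp

/-- At m = 0 the weight is c = cos(θ/2), so the derivative has integrand c² - 2ac³F, and 4c³ = 3c +
cos(3θ/2) brings in the coefficient with m = 1. -/
theorem hasDerivAt_dawsonCoeff_zero (a : ℂ) :
    HasDerivAt (dawsonCoeff 0)
      (Real.pi / 2 - a * (3 / 2 * dawsonCoeff 0 a + 1 / 2 * dawsonCoeff 1 a)) a := by
  have h := hasDerivAt_intervalIntegral_of_continuous
    (f := fun a θ => dawson (a * Complex.cos ((θ : ℂ) / 2)) *
      Complex.cos ((((0 : ℤ) : ℂ) + 1 / 2) * θ))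
    (f' := fun a θ => (1 - 2 * (a * Complex.cos ((θ : ℂ) / 2)) *
      dawson (a * Complex.cos ((θ : ℂ) / 2))) * Complex.cos ((θ : ℂ) / 2) *
      Complex.cos ((((0 : ℤ) : ℂ) + 1 / 2) * θ)) 0 Real.pi
    (by fun_prop) (fun x => by fun_prop) (fun x t => by
      have h1 : HasDerivAt (fun y : ℂ => y * Complex.cos ((t : ℂ) / 2))
          (Complex.cos ((t : ℂ) / 2)) x := by
        simpa using (hasDerivAt_id' x).mul_const (Complex.cos ((t : ℂ) / 2))
      have h2 : HasDerivAt (fun y : ℂ => dawson (y * Complex.cos ((t : ℂ) / 2))) _ x :=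
        (hasDerivAt_dawson _).comp x h1
      exact h2.mul_const _) a
  refine HasDerivAt.congr_deriv (f := dawsonCoeff 0) h ?_
  rw [← integral_cos_half_sq]
  simp only [dawsonCoeff, ← intervalIntegral.integral_const_mul]
  rw [← intervalIntegral.integral_add, ← intervalIntegral.integral_const_mul,
    ← intervalIntegral.integral_sub]
  · refine intervalIntegral.integral_congr fun θ _ => ?_
    have e0 : (((0 : ℤ) : ℂ) + 1 / 2) * θ = θ / 2 := by push_cast; ring
    have e1 : (((1 : ℤ) : ℂ) + 1 / 2) * θ = 3 * (θ / 2) := by push_cast; ring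
    simp only [e0, e1, Complex.cos_three_mul]
    ring
  all_goals exact Continuous.intervalIntegrable (by fun_prop) _ _

/-- By the recurrence at m = 0 and D_{-1} = D_0, D_1 drops out of the derivative of e^{a²} a D_0,
leaving π a e^{a²}. Both sides vanish at a = 0. -/
theorem mul_dawsonCoeff_zero (a : ℂ) :
    Complex.exp (a ^ 2) * (a * dawsonCoeff 0 a) = Real.pi / 2 * (Complex.exp (a ^ 2) - 1) := by
  have hrec : ∀ a : ℂ, a ^ 2 * (dawsonCoeff 1 a - dawsonCoeff 0 a) =
      2 * dawsonCoeff 0 a - a * Real.pi := fun a => by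
    have := dawsonCoeff_recurrence 0 a
    rw [sinHalfIntegral_eq, zero_add, zero_sub, dawsonCoeff_neg_one] at this
    simp at this
    linear_combination this
  have hd : ∀ a : ℂ, HasDerivAt (fun a : ℂ => Complex.exp (a ^ 2) * (a * dawsonCoeff 0 a) -
      Real.pi / 2 * (Complex.exp (a ^ 2) - 1)) 0 a := fun a => by
    have h1 : HasDerivAt (fun w : ℂ => w ^ 2) (2 * a) a := by
      refine ((hasDerivAt_id' a).fun_pow 2).congr_deriv ?_
      simp
    refine ((h1.cexp.fun_mul ((hasDerivAt_id' a).fun_mul (hasDerivAt_dawsonCoeff_zero a))).fun_sub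
      ((h1.cexp.sub_const 1).const_mul ((Real.pi : ℂ) / 2))).congr_deriv ?_
    linear_combination (-1 / 2 * Complex.exp (a ^ 2)) * hrec a
  have h := is_const_of_deriv_eq_zero (fun a => (hd a).differentiableAt) (fun a => (hd a).deriv) a 0
  simpa [sub_eq_zero] using h

/-! ### The finite sum -/

/-- The coefficients `(n+k)! / ((n-k)! k!)`, zero for `k > n`. -/
def besselPolyCoeff (n k : ℕ) : ℂ :=
  ((n + k).choose (2 * k) : ℂ) * ((2 * k).factorial / k.factorial)

theorem besselPolyCoeff_eq_zero {n k : ℕ} (h : n < k) : besselPolyCoeff n k = 0 := by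
  rw [besselPolyCoeff, Nat.choose_eq_zero_of_lt (by omega)]
  simp

theorem besselPolyCoeff_eq {n k : ℕ} (h : k ≤ n) :
    besselPolyCoeff n k = (n + k).factorial / ((n - k).factorial * k.factorial) := by
  rw [besselPolyCoeff, Nat.cast_choose ℂ (by omega), show n + k - 2 * k = n - k by omega]
  have h1 : ((2 * k).factorial : ℂ) ≠ 0 := by exact_mod_cast Nat.factorial_ne_zero _
  have h2 : (k.factorial : ℂ) ≠ 0 := by exact_mod_cast Nat.factorial_ne_zero _
  have h3 : ((n - k).factorial : ℂ) ≠ 0 := by exact_mod_cast Nat.factorial_ne_zero _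
  field_simp

theorem besselPolyCoeff_zero_right (n : ℕ) : besselPolyCoeff n 0 = 1 := by simp [besselPolyCoeff]

/-- Pascal's rule twice, then absorption identities for binomials. The binomial form vanishes for k
> n, so no boundary cases arise. -/
theorem besselPolyCoeff_recurrence (n k : ℕ) :
    besselPolyCoeff (n + 2) (k + 1) =
      besselPolyCoeff n (k + 1) + 2 * (2 * n + 3) * besselPolyCoeff (n + 1) k := by
  set N := n + k + 1 with hN
  have a1 : (((n + 2) + (k + 1)).choose (2 * (k + 1)) : ℂ) =
      (N + 1).choose (2 * k + 1) + (N.choose (2 * k + 1) + N.choose (2 * k + 2)) := by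
    rw [show (n + 2) + (k + 1) = N + 1 + 1 by omega, show 2 * (k + 1) = 2 * k + 1 + 1 by omega,
      Nat.choose_succ_succ (N + 1), Nat.choose_succ_succ N (2 * k + 1)]
    push_cast; ring
  have a2 : ((N + 1 : ℂ)) * N.choose (2 * k) = (N + 1).choose (2 * k + 1) * (2 * k + 1) := by
    exact_mod_cast Nat.add_one_mul_choose_eq N (2 * k)
  have a3 : (N.choose (2 * k + 1) : ℂ) * (2 * k + 1) = N.choose (2 * k) * (N - 2 * k) := by
    rcases le_or_gt (2 * k) N with h | h
    · have := Nat.choose_succ_right_eq N (2 * k)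
      have h' := congrArg (Nat.cast : ℕ → ℂ) this
      push_cast [Nat.cast_sub h] at h'
      exact h'
    · rw [Nat.choose_eq_zero_of_lt h, Nat.choose_eq_zero_of_lt (by omega : N < 2 * k + 1)]
      simp
  have a4 : (((2 * (k + 1)).factorial : ℂ)) / (k + 1).factorial =
      2 * (2 * k + 1) * ((2 * k).factorial / k.factorial) := by
    have h2 : (k.factorial : ℂ) ≠ 0 := by exact_mod_cast Nat.factorial_ne_zero _
    have h3 : (k + 1 : ℂ) ≠ 0 := by exact_mod_cast Nat.succ_ne_zero k
    rw [show 2 * (k + 1) = 2 * k + 1 + 1 by omega, Nat.factorial_succ, Nat.factorial_succ,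
      Nat.factorial_succ k]
    push_cast
    field_simp
    ring
  have hNc : (N : ℂ) = n + k + 1 := by rw [hN]; push_cast; ring
  simp only [besselPolyCoeff]
  rw [a1, a4, show n + (k + 1) = N by omega, show n + 1 + k = N by omega,
    show 2 * (k + 1) = 2 * k + 2 by omega]
  rw [hNc] at a2 a3
  linear_combination (2 * ((2 * k).factorial / k.factorial : ℂ)) * (a3 - a2)

/-- The finite sum in the formula for the spherical Bessel function. -/
def besselPolySum (m : ℤ) (s : ℂ) : ℂ :=
  ∑ j ∈ Finset.Icc (0 : ℤ) m,
    ((2 * m - j).toNat.factorial : ℂ) /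
        ((j.toNat.factorial : ℂ) * ((m - j).toNat.factorial : ℂ)) * s ^ (2 * j - 2 * m - 1)

theorem besselPolySum_of_neg {m : ℤ} (hm : m < 0) (s : ℂ) : besselPolySum m s = 0 := by
  simp [besselPolySum, Finset.Icc_eq_empty (not_le.2 hm)]

/-- Reindexed by k = n - j. The free bound N lets sums of different degrees be compared over one
range. -/
theorem besselPolySum_natCast (n N : ℕ) (h : n < N) (s : ℂ) :
    besselPolySum n s = ∑ k ∈ Finset.range N, besselPolyCoeff n k * s⁻¹ ^ (2 * k + 1) := by
  have h1 : ∑ k ∈ Finset.range N, besselPolyCoeff n k * s⁻¹ ^ (2 * k + 1) =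
      ∑ k ∈ Finset.range (n + 1), besselPolyCoeff n k * s⁻¹ ^ (2 * k + 1) := by
    symm
    refine Finset.sum_subset (Finset.range_subset_range.2 h) fun k _ hk => ?_
    rw [besselPolyCoeff_eq_zero (by simpa using hk), zero_mul]
  rw [h1, besselPolySum]
  refine Finset.sum_bij' (fun j _ => (n - j).toNat) (fun k _ => (n : ℤ) - k) ?_ ?_ ?_ ?_ ?_
  · intro j hj; simp only [Finset.mem_Icc] at hj; simp only [Finset.mem_range]; omega
  · intro k hk; simp only [Finset.mem_range] at hk; simp only [Finset.mem_Icc]; omega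
  · intro j hj; simp only [Finset.mem_Icc] at hj; omega
  · intro k hk; simp only [Finset.mem_range] at hk; omega
  · intro j hj
    simp only [Finset.mem_Icc] at hj
    obtain ⟨k, hk⟩ : ∃ k : ℕ, (n : ℤ) - j = k := ⟨(n - j).toNat, by omega⟩
    obtain rfl : j = n - k := by omega
    have hkn : k ≤ n := by omega
    rw [show ((n : ℤ) - (n - k)).toNat = k by omega, besselPolyCoeff_eq hkn,
      show (2 * (n : ℤ) - (n - k)).toNat = n + k by omega,
      show ((n : ℤ) - k).toNat = n - k by omega,
      show 2 * ((n : ℤ) - k) - 2 * n - 1 = -((2 * k + 1 : ℕ) : ℤ) by push_cast; ring,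
      zpow_neg, zpow_natCast, inv_pow]

theorem besselPolySum_natCast_recurrence (n : ℕ) {s : ℂ} (hs : s ≠ 0) :
    s ^ 2 * (besselPolySum (n + 2 : ℕ) s - besselPolySum n s) =
      (4 * n + 6) * besselPolySum (n + 1 : ℕ) s := by
  rw [besselPolySum_natCast (n + 2) (n + 3 + 1) (by omega),
    besselPolySum_natCast n (n + 3 + 1) (by omega),
    besselPolySum_natCast (n + 1) (n + 3) (by omega), Finset.sum_range_succ',
    Finset.sum_range_succ' _ (n + 3), besselPolyCoeff_zero_right, besselPolyCoeff_zero_right,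
    add_sub_add_right_eq_sub, ← Finset.sum_sub_distrib, Finset.mul_sum, Finset.mul_sum]
  refine Finset.sum_congr rfl fun k _ => ?_
  rw [besselPolyCoeff_recurrence, show 2 * (k + 1) + 1 = 2 * k + 1 + 2 by ring, pow_add]
  field_simp
  ring

theorem besselPolySum_zero (s : ℂ) : besselPolySum 0 s = s⁻¹ := by
  simpa [besselPolyCoeff_zero_right] using besselPolySum_natCast 0 1 one_pos s

theorem besselPolySum_one {s : ℂ} : besselPolySum 1 s = s⁻¹ + 2 * s⁻¹ ^ 3 := by
  simpa [Finset.sum_range_succ, besselPolyCoeff_zero_right, besselPolyCoeff] using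
    besselPolySum_natCast 1 2 (by omega) s

/-! ### Bessel series of half-integer order -/

theorem half_sub_int_add_nat_ne_zero (m : ℤ) (k : ℕ) : (1 / 2 : ℂ) - m + k ≠ 0 := by
  intro h
  have h1 : ((1 - 2 * m + 2 * k : ℤ) : ℂ) = 0 := by push_cast; linear_combination 2 * h
  have h2 : 1 - 2 * m + 2 * k = 0 := by exact_mod_cast h1
  omega

/-- The `k`-th term of the power series in `J_{-m-1/2}`, as a function of `x = z/2`. -/
def besselTerm (m : ℤ) (x : ℂ) (k : ℕ) : ℂ :=
  (-1) ^ k * x ^ (2 * k) / ((k.factorial : ℂ) * Complex.Gamma (1 / 2 - m + k))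

theorem besselTerm_add_one (m : ℤ) (x : ℂ) (k : ℕ) :
    besselTerm (m + 1) x k = (k - 1 / 2 - m) * besselTerm m x k := by
  have h := half_sub_int_add_nat_ne_zero (m + 1) k
  have hG := Complex.Gamma_add_one _ h
  rw [show (1 / 2 : ℂ) - ((m + 1 : ℤ) : ℂ) + k + 1 = 1 / 2 - m + k by push_cast; ring] at hG
  rw [besselTerm, besselTerm, hG,
    show (k : ℂ) - 1 / 2 - m = 1 / 2 - ((m + 1 : ℤ) : ℂ) + k by push_cast; ring]
  generalize (1 / 2 : ℂ) - ((m + 1 : ℤ) : ℂ) + k = w at h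
  rw [mul_left_comm _ w, ← mul_div_assoc, mul_div_mul_left _ _ h]

theorem sq_mul_besselTerm_sub_one (m : ℤ) (x : ℂ) (k : ℕ) :
    x ^ 2 * besselTerm (m - 1) x k = -(k + 1) * besselTerm m x (k + 1) := by
  have h : (k + 1 : ℂ) ≠ 0 := by exact_mod_cast Nat.succ_ne_zero k
  rw [besselTerm, besselTerm,
    show (1 / 2 : ℂ) - ((m - 1 : ℤ) : ℂ) + k = 1 / 2 - m + (k + 1 : ℕ) by push_cast; ring,
    Nat.factorial_succ, Nat.cast_mul, Nat.cast_succ, mul_assoc, neg_mul, ← mul_div_assoc,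
    ← mul_div_assoc, mul_div_mul_left _ _ h, ← neg_div]
  congr 1
  ring

/-- The Bessel recurrence termwise: Γ(w+1) = wΓ(w) handles m + 1, while m - 1 amounts to a shift of
k by one. -/
theorem besselTerm_recurrence (m : ℤ) (x : ℂ) (k : ℕ) :
    x ^ 2 * besselTerm (m - 1) x k + besselTerm (m + 1) x (k + 1) =
      -(m + 1 / 2) * besselTerm m x (k + 1) := by
  rw [sq_mul_besselTerm_sub_one, besselTerm_add_one]
  push_cast
  ring

theorem Gamma_half_add_nat (k : ℕ) :
    Complex.Gamma (1 / 2 + k) =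
      (2 * k).factorial * (Real.sqrt Real.pi : ℂ) / (4 ^ k * k.factorial) := by
  induction k with
  | zero =>
    have : Complex.Gamma (1 / 2) = (Real.sqrt Real.pi : ℂ) := by
      rw [← Real.Gamma_one_half_eq, ← Complex.Gamma_ofReal]; norm_num
    simp [← this]
  | succ k ih =>
    have h := half_sub_int_add_nat_ne_zero 0 k
    simp only [Int.cast_zero, sub_zero] at h
    have h2 : (k.factorial : ℂ) ≠ 0 := by exact_mod_cast Nat.factorial_ne_zero _
    have h3 : (k + 1 : ℂ) ≠ 0 := by exact_mod_cast Nat.succ_ne_zero k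
    rw [Nat.cast_succ, ← add_assoc, Complex.Gamma_add_one _ h, ih,
      show 2 * (k + 1) = 2 * k + 1 + 1 by omega, Nat.factorial_succ, Nat.factorial_succ,
      Nat.factorial_succ k]
    push_cast
    field_simp
    ring

theorem sqrt_pi_ne_zero : (Real.sqrt Real.pi : ℂ) ≠ 0 := by
  exact_mod_cast (Real.sqrt_pos.2 Real.pi_pos).ne'

theorem hasSum_besselTerm_zero (x : ℂ) :
    HasSum (besselTerm 0 x) (Complex.cos (2 * x) / (Real.sqrt Real.pi : ℂ)) := by
  refine ((Complex.hasSum_cos (2 * x)).div_const _).congr_fun fun k => ?_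
  have h1 : (k.factorial : ℂ) ≠ 0 := by exact_mod_cast Nat.factorial_ne_zero _
  have h2 : ((2 * k).factorial : ℂ) ≠ 0 := by exact_mod_cast Nat.factorial_ne_zero _
  have h3 := sqrt_pi_ne_zero
  rw [besselTerm, Int.cast_zero, sub_zero, Gamma_half_add_nat, mul_pow, pow_mul 2]
  field_simp
  norm_num

theorem hasSum_besselTerm_neg_one {x : ℂ} (hx : x ≠ 0) :
    HasSum (besselTerm (-1) x) (Complex.sin (2 * x) / (x * (Real.sqrt Real.pi : ℂ))) := by
  refine ((Complex.hasSum_sin (2 * x)).div_const _).congr_fun fun k => ?_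
  have h1 : (k.factorial : ℂ) ≠ 0 := by exact_mod_cast Nat.factorial_ne_zero _
  have h2 : ((2 * k + 1).factorial : ℂ) ≠ 0 := by exact_mod_cast Nat.factorial_ne_zero _
  have h3 := sqrt_pi_ne_zero
  have h4 : (k + 1 : ℂ) ≠ 0 := by exact_mod_cast Nat.succ_ne_zero k
  rw [besselTerm, show (1 / 2 : ℂ) - ((-1 : ℤ) : ℂ) + k = 1 / 2 + (k + 1 : ℕ) by push_cast; ring,
    Gamma_half_add_nat, show 2 * (k + 1) = 2 * k + 1 + 1 by omega, Nat.factorial_succ (2 * k + 1),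
    Nat.factorial_succ k, mul_pow, pow_succ (2 : ℂ), pow_mul 2]
  push_cast
  rw [show (2 * k + 1 + 1 : ℂ) = 2 * (k + 1) by ring]
  field_simp
  ring

theorem hasSum_besselTerm_add_one {m : ℤ} {x A B : ℂ} (hA : HasSum (besselTerm (m - 1) x) A)
    (hB : HasSum (besselTerm m x) B) :
    HasSum (besselTerm (m + 1) x) (-(m + 1 / 2) * B - x ^ 2 * A) := by
  -- The m - 1 series pairs with the others shifted by one, so their k = 0 terms are split off and
  -- matched separately.
  rw [← hasSum_nat_add_iff' 1] at hB ⊢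
  convert (hB.mul_left (-(m + 1 / 2 : ℂ))).sub (hA.mul_left (x ^ 2)) using 1
  · funext k
    linear_combination besselTerm_recurrence m x k
  · rw [Finset.sum_range_one, Finset.sum_range_one, besselTerm_add_one]
    push_cast
    ring

theorem hasSum_besselTerm_sub_one {m : ℤ} {x B C : ℂ} (hx : x ≠ 0)
    (hB : HasSum (besselTerm m x) B) (hC : HasSum (besselTerm (m + 1) x) C) :
    HasSum (besselTerm (m - 1) x) ((-(m + 1 / 2) * B - C) / x ^ 2) := by
  rw [← hasSum_nat_add_iff' 1] at hB hC
  have h := (((hB.mul_left (-(m + 1 / 2 : ℂ))).sub hC).div_const (x ^ 2)).congr_fun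
    (g := besselTerm (m - 1) x) fun k => by
      rw [eq_div_iff (pow_ne_zero 2 hx)]
      linear_combination besselTerm_recurrence m x k
  rw [Finset.sum_range_one, Finset.sum_range_one, besselTerm_add_one] at h
  refine (congrArg (HasSum _) ?_).mp h
  push_cast
  ring

/-- A solution of the three-term recurrence of the spherical Bessel functions of the second kind
with the right values at `0` and `-1` gives the sums of the Bessel series. -/
theorem hasSum_besselTerm_of_recurrence {x : ℂ} (hx : x ≠ 0) {Y : ℤ → ℂ}
    (h0 : Y 0 = -Complex.cos (2 * x) / (2 * x)) (h1 : Y (-1) = Complex.sin (2 * x) / (2 * x))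
    (hrec : ∀ m : ℤ, Y (m - 1) + Y (m + 1) = (2 * m + 1) / (2 * x) * Y m) (m : ℤ) :
    HasSum (besselTerm m x)
      (2 / (Real.sqrt Real.pi : ℂ) * (-1) ^ (m + 1) * x ^ (m + 1) * Y m) := by
  have hneg : (-1 : ℂ) ≠ 0 := by simp
  -- A second-order recurrence needs two consecutive indices in the induction, which runs in both
  -- directions.
  suffices h : ∀ m : ℤ, HasSum (besselTerm (m - 1) x)
        (2 / (Real.sqrt Real.pi : ℂ) * (-1) ^ m * x ^ m * Y (m - 1)) ∧
      HasSum (besselTerm m x)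
        (2 / (Real.sqrt Real.pi : ℂ) * (-1) ^ (m + 1) * x ^ (m + 1) * Y m) from (h m).2
  intro m
  induction m using Int.induction_on with
  | zero =>
    have h3 := sqrt_pi_ne_zero
    constructor
    · rw [zero_sub]
      convert hasSum_besselTerm_neg_one hx using 1
      rw [h1, zpow_zero, zpow_zero]
      field_simp
    · convert hasSum_besselTerm_zero x using 1
      rw [h0, zero_add, zpow_one, zpow_one]
      field_simp
  | succ n ih =>
    obtain ⟨hA, hB⟩ := ih
    rw [add_sub_cancel_right]
    refine ⟨hB, ?_⟩
    convert hasSum_besselTerm_add_one hA hB using 1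
    have := hrec n
    rw [← eq_sub_iff_add_eq'] at this
    rw [this, zpow_add_one₀ hneg, zpow_add_one₀ hneg, zpow_add_one₀ hx, zpow_add_one₀ hx]
    field_simp
  | pred n ih =>
    obtain ⟨hB, hC⟩ := ih
    rw [sub_add_cancel]
    refine ⟨?_, hB⟩
    have hC' : HasSum (besselTerm (-(n : ℤ) - 1 + 1) x)
        (2 / (Real.sqrt Real.pi : ℂ) * (-1) ^ (-(n : ℤ) + 1) * x ^ (-(n : ℤ) + 1) * Y (-n)) := by
      rw [sub_add_cancel]; exact hC
    convert hasSum_besselTerm_sub_one hx hB hC' using 1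
    have := hrec (-(n : ℤ) - 1)
    rw [← eq_sub_iff_add_eq, sub_add_cancel] at this
    rw [this, zpow_add_one₀ hneg, zpow_add_one₀ hx, zpow_sub_one₀ hneg, zpow_sub_one₀ hx]
    push_cast
    field_simp
    ring

theorem half_int_ne_int (m n : ℤ) : (m : ℂ) + 1 / 2 ≠ n := by
  intro h
  have h1 : ((2 * m + 1 : ℤ) : ℂ) = (2 * n : ℤ) := by push_cast; linear_combination 2 * h
  have h2 : 2 * m + 1 = 2 * n := by exact_mod_cast h1
  omega

/-- At order m + 1/2 the cosine vanishes and the sine is (-1)^m, leaving only J_{-m-1/2}. -/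
theorem besselY_int_add_half (m : ℤ) (z : ℂ) :
    besselY (m + 1 / 2) z =
      (-1) ^ (m + 1) * ((z / 2) ^ (-((m : ℂ) + 1 / 2)) * ∑' k, besselTerm m (z / 2) k) := by
  have hc : Complex.cos (((m : ℂ) + 1 / 2) * Real.pi) = 0 := by
    rw [show ((m : ℂ) + 1 / 2) * Real.pi = m * Real.pi + Real.pi / 2 by ring,
      Complex.cos_add_pi_div_two, Complex.sin_int_mul_pi, neg_zero]
  have hs : Complex.sin (((m : ℂ) + 1 / 2) * Real.pi) = (-1) ^ m := by
    rw [show ((m : ℂ) + 1 / 2) * Real.pi = m * Real.pi + Real.pi / 2 by ring,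
      Complex.sin_add_pi_div_two]
    have h := congrArg Complex.ofReal (Real.cos_int_mul_pi m)
    push_cast at h
    exact h
  have hinv : ((-1 : ℂ) ^ m)⁻¹ = (-1) ^ m := by
    rw [← inv_zpow, inv_neg_one]
  rw [besselY, if_neg (by rintro ⟨n, hn⟩; exact half_int_ne_int m n hn), besselYQuotient, hc, hs,
    mul_zero, zero_sub, div_eq_mul_inv, hinv, zpow_add_one₀ (by simp : (-1 : ℂ) ≠ 0), besselJ]
  have : ∀ k : ℕ, (-((m : ℂ) + 1 / 2) + k + 1) = 1 / 2 - m + k := fun k => by ring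
  simp only [this, besselTerm]
  ring

theorem ofReal_mul_cpow {r : ℝ} (hr : 0 < r) {w : ℂ} (hw : w ≠ 0) (a : ℂ) :
    ((r : ℂ) * w) ^ a = (r : ℂ) ^ a * w ^ a := by
  have hr' : (r : ℂ) ≠ 0 := by exact_mod_cast hr.ne'
  rw [Complex.cpow_def_of_ne_zero (mul_ne_zero hr' hw), Complex.cpow_def_of_ne_zero hr',
    Complex.cpow_def_of_ne_zero hw, Complex.log_ofReal_mul hr hw, Complex.ofReal_log hr.le,
    add_mul, Complex.exp_add]

theorem sqrt_pi_div {z : ℂ} (hz : z ∈ Complex.slitPlane) :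
    Complex.sqrt (Real.pi / (2 * z)) =
      (Real.sqrt Real.pi : ℂ) / 2 * (z / 2) ^ (-(1 / 2) : ℂ) := by
  have harg : (z / 2).arg ≠ Real.pi := by
    rw [show z / 2 = ((1 / 2 : ℝ) : ℂ) * z by push_cast; ring,
      Complex.arg_real_mul _ (by norm_num)]
    exact Complex.slitPlane_arg_ne_pi hz
  have hz0 := Complex.slitPlane_ne_zero hz
  have hr : 0 < Real.pi / 4 := by positivity
  rw [Complex.sqrt, show (Real.pi : ℂ) / (2 * z) = ((Real.pi / 4 : ℝ) : ℂ) * (z / 2)⁻¹ by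
    push_cast; field_simp; norm_num,
    ofReal_mul_cpow hr (inv_ne_zero (div_ne_zero hz0 two_ne_zero)), Complex.inv_cpow _ _ harg, Complex.cpow_neg]
  congr 1
  · rw [show (2⁻¹ : ℂ) = ((1 / 2 : ℝ) : ℂ) by push_cast; norm_num, ← Complex.ofReal_cpow hr.le,
      ← Real.sqrt_eq_rpow, Real.sqrt_div Real.pi_pos.le, show (4 : ℝ) = 2 ^ 2 by norm_num,
      Real.sqrt_sq (by norm_num)]
    push_cast; rfl
  · norm_num

/-- Uniqueness for the recurrence. The principal powers of z/2 share a base, so they combine to the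
integer power -(m+1) with no branch correction. -/
theorem sphericalBesselY_eq (m : ℤ) {z : ℂ} (hz : z ∈ Complex.slitPlane) {Y : ℤ → ℂ}
    (h0 : Y 0 = -Complex.cos z / z) (h1 : Y (-1) = Complex.sin z / z)
    (hrec : ∀ m : ℤ, Y (m - 1) + Y (m + 1) = (2 * m + 1) / z * Y m) :
    sphericalBesselY m z = Y m := by
  have hz0 := Complex.slitPlane_ne_zero hz
  have hx : z / 2 ≠ 0 := div_ne_zero hz0 two_ne_zero
  have e : 2 * (z / 2) = z := by ring
  have key := hasSum_besselTerm_of_recurrence hx (Y := Y) (by rw [e, h0]) (by rw [e, h1])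
    (by rw [e]; exact hrec) m
  have hpow : (z / 2) ^ (-(1 / 2) : ℂ) * (z / 2) ^ (-((m : ℂ) + 1 / 2)) =
      ((z / 2) ^ (m + 1))⁻¹ := by
    rw [← Complex.cpow_add _ _ hx, ← zpow_neg, ← Complex.cpow_intCast]
    congr 1
    push_cast
    ring
  have hsq : ((-1 : ℂ) ^ (m + 1)) * (-1) ^ (m + 1) = 1 := by
    rw [← mul_zpow]; simp
  have h3 := sqrt_pi_ne_zero
  have h4 := zpow_ne_zero (m + 1) hx
  rw [sphericalBesselY, sqrt_pi_div hz, besselY_int_add_half, key.tsum_eq]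
  calc _ = ((Real.sqrt Real.pi : ℂ) / 2 * (2 / (Real.sqrt Real.pi : ℂ))) *
        ((-1 : ℂ) ^ (m + 1) * (-1) ^ (m + 1)) *
        (((z / 2) ^ (-(1 / 2) : ℂ) * (z / 2) ^ (-((m : ℂ) + 1 / 2))) * (z / 2) ^ (m + 1)) * Y m := by
        ring
    _ = Y m := by
      rw [hsq, hpow, inv_mul_cancel₀ h4]
      field_simp

/-! ### The right-hand side solves the recurrence -/

theorem besselPolySum_recurrence (m : ℤ) {s : ℂ} (hs : s ≠ 0) :
    s ^ 2 * (besselPolySum (m + 1) s - besselPolySum (m - 1) s) =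
      (4 * m + 2) * besselPolySum m s + (-1) ^ m * (2 * s / Real.pi) * sinHalfIntegral m := by
  have hpi : (Real.pi : ℂ) ≠ 0 := by exact_mod_cast Real.pi_ne_zero
  rw [sinHalfIntegral_eq]
  rcases lt_trichotomy m (-1) with h | rfl | h
  · rw [besselPolySum_of_neg (by omega), besselPolySum_of_neg (by omega),
      besselPolySum_of_neg (by omega), if_neg (by omega), if_neg (by omega)]
    ring
  · rw [besselPolySum_of_neg (m := -1 - 1) (by omega), besselPolySum_of_neg (m := -1) (by omega),
      neg_add_cancel, besselPolySum_zero]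
    simp
    field_simp
  · obtain ⟨n, rfl⟩ : ∃ n : ℕ, m = n := ⟨m.toNat, by omega⟩
    rcases n with _ | n
    · simp only [Nat.cast_zero, zero_add, besselPolySum_one, besselPolySum_zero]
      rw [besselPolySum_of_neg (by omega)]
      simp
      field_simp
      ring
    · have := besselPolySum_natCast_recurrence n hs
      rw [if_neg (by omega), if_neg (by omega)]
      rw [show ((n + 1 : ℕ) : ℤ) + 1 = (n + 2 : ℕ) by push_cast; ring,
        show ((n + 1 : ℕ) : ℤ) - 1 = n by push_cast; ring, this]
      push_cast
      ring

/-- The right-hand side of the formula for `y_m(z)`, for a choice of `s = √(-2iz)`. -/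
def sphericalBesselYDawson (z s : ℂ) (m : ℤ) : ℂ :=
  (2 / s) * Complex.exp (Complex.I * z) * Complex.I ^ m *
    (-(1 / (Real.pi : ℂ)) * dawsonCoeff m (-Complex.I * s) +
      Complex.I * (-1) ^ m * besselPolySum m s)

theorem sphericalBesselYDawson_recurrence {z s : ℂ} (hs : s ^ 2 = -2 * Complex.I * z)
    (hs0 : s ≠ 0) (m : ℤ) :
    sphericalBesselYDawson z s (m - 1) + sphericalBesselYDawson z s (m + 1) =
      (2 * m + 1) / z * sphericalBesselYDawson z s m := by
  have hz : z = Complex.I * s ^ 2 / 2 := by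
    rw [hs]; linear_combination z * Complex.I_sq
  have hz0 : z ≠ 0 := by
    rw [hz]; exact div_ne_zero (mul_ne_zero Complex.I_ne_zero (pow_ne_zero 2 hs0)) two_ne_zero
  have hD := dawsonCoeff_recurrence m (-Complex.I * s)
  rw [mul_pow, neg_sq, Complex.I_sq] at hD
  have hP := besselPolySum_recurrence m hs0
  have hneg : (-1 : ℂ) ≠ 0 := by simp
  have hm : ((-1 : ℂ) ^ m) * (-1) ^ m = 1 := by rw [← mul_zpow]; simp
  -- The source terms of `hD` and `hP` cancel here. The sign -(-1)^m is the value of (-1)^(m ± 1).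
  have key : s ^ 2 * ((-(1 / (Real.pi : ℂ)) * dawsonCoeff (m + 1) (-Complex.I * s) +
        Complex.I * -(-1) ^ m * besselPolySum (m + 1) s) -
      (-(1 / (Real.pi : ℂ)) * dawsonCoeff (m - 1) (-Complex.I * s) +
        Complex.I * -(-1) ^ m * besselPolySum (m - 1) s)) =
      -(4 * m + 2) * (-(1 / (Real.pi : ℂ)) * dawsonCoeff m (-Complex.I * s) +
        Complex.I * (-1) ^ m * besselPolySum m s) := by
    linear_combination (1 / (Real.pi : ℂ)) * hD - Complex.I * (-1) ^ m * hP -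
      Complex.I * (2 * s / Real.pi) * sinHalfIntegral m * hm
  have hc : (2 * (m : ℂ) + 1) / z * s ^ 2 = -(Complex.I * (4 * m + 2)) := by
    rw [hs]
    field_simp
    ring
  have hI : Complex.I ^ (m - 1) = -Complex.I * Complex.I ^ m := by
    rw [zpow_sub_one₀ Complex.I_ne_zero, Complex.inv_I]
    ring
  have hs2 : s ^ 2 ≠ 0 := pow_ne_zero 2 hs0
  refine mul_left_cancel₀ hs2 ?_
  simp only [sphericalBesselYDawson]
  rw [hI, zpow_add_one₀ Complex.I_ne_zero, zpow_add_one₀ hneg, zpow_sub_one₀ hneg, inv_neg_one,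
    mul_neg_one]
  linear_combination ((2 / s) * Complex.exp (Complex.I * z) * Complex.I ^ m) *
    (Complex.I * key - (-(1 / (Real.pi : ℂ)) * dawsonCoeff m (-Complex.I * s) +
      Complex.I * (-1) ^ m * besselPolySum m s) * hc)

/-- With a = -is one has a² = 2iz, so the closed form of D_0 contains e^{2iz} - 1 = 2i e^{iz} sin z.
-/
theorem exp_mul_dawsonCoeff_zero {z s : ℂ} (hs : s ^ 2 = -2 * Complex.I * z) (hs0 : s ≠ 0) :
    (2 / s) * Complex.exp (Complex.I * z) *
      (-(1 / (Real.pi : ℂ)) * dawsonCoeff 0 (-Complex.I * s)) = Complex.I * Complex.sin z / z := by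
  have hpi : (Real.pi : ℂ) ≠ 0 := by exact_mod_cast Real.pi_ne_zero
  have h := mul_dawsonCoeff_zero (-Complex.I * s)
  have hz0 : z ≠ 0 := by
    rintro rfl
    simp [hs0] at hs
  rw [show (-Complex.I * s) ^ 2 = Complex.I * z + Complex.I * z by
    rw [mul_pow, hs, neg_sq, Complex.I_sq]; ring, Complex.exp_add] at h
  have he : Complex.exp (Complex.I * z) ≠ 0 := Complex.exp_ne_zero _
  have hsin : Complex.sin z * Complex.exp (Complex.I * z) * (2 * Complex.I) =
      Complex.exp (Complex.I * z) * Complex.exp (Complex.I * z) - 1 := by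
    have h1 : Complex.exp (-z * Complex.I) * Complex.exp (Complex.I * z) = 1 := by
      rw [← Complex.exp_add]; simp [mul_comm]
    rw [Complex.sin, mul_comm z Complex.I]
    linear_combination (-1 : ℂ) * h1 + ((Complex.exp (-z * Complex.I) -
      Complex.exp (Complex.I * z)) * Complex.exp (Complex.I * z)) * Complex.I_sq
  rw [← hsin] at h
  have h2 : Complex.exp (Complex.I * z) * s * dawsonCoeff 0 (-Complex.I * s) =
      -(Real.pi * Complex.sin z) := by
    refine mul_left_cancel₀ (mul_ne_zero he Complex.I_ne_zero) ?_
    linear_combination -h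
  have hz : z = Complex.I * s ^ 2 / 2 := by
    rw [hs]; linear_combination z * Complex.I_sq
  have h3 : Complex.I * Complex.sin z / z = 2 * Complex.sin z / s ^ 2 := by
    rw [div_eq_div_iff hz0 (pow_ne_zero 2 hs0)]
    linear_combination (-2 * Complex.sin z) * hz
  rw [h3]
  generalize dawsonCoeff 0 (-Complex.I * s) = D at h2
  field_simp
  linear_combination -h2

theorem sphericalBesselYDawson_neg_one {z s : ℂ} (hs : s ^ 2 = -2 * Complex.I * z)
    (hs0 : s ≠ 0) : sphericalBesselYDawson z s (-1) = Complex.sin z / z := by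
  rw [sphericalBesselYDawson, dawsonCoeff_neg_one, besselPolySum_of_neg (by omega), mul_zero,
    add_zero, mul_right_comm, exp_mul_dawsonCoeff_zero hs hs0, zpow_neg_one, Complex.inv_I]
  linear_combination (-(Complex.sin z / z)) * Complex.I_sq

/-- The single term of the sum contributes -e^{iz}/z, which cancels i sin z/z down to -cos z/z. -/
theorem sphericalBesselYDawson_zero {z s : ℂ} (hs : s ^ 2 = -2 * Complex.I * z)
    (hs0 : s ≠ 0) : sphericalBesselYDawson z s 0 = -Complex.cos z / z := by
  have hz0 : z ≠ 0 := by
    rintro rfl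
    simp [hs0] at hs
  rw [sphericalBesselYDawson, zpow_zero, zpow_zero, mul_one, mul_one, mul_add,
    exp_mul_dawsonCoeff_zero hs hs0, besselPolySum_zero]
  have h1 : 2 / s * Complex.exp (Complex.I * z) * (Complex.I * s⁻¹) =
      2 * Complex.I * Complex.exp (Complex.I * z) / s ^ 2 := by
    field_simp
  rw [h1, hs, mul_comm Complex.I z, Complex.exp_mul_I]
  field_simp
  ring

/-! ### Principal values -/

/-- Since 2i/z = 4/(-2iz), the positive factor 4 comes out as 2, and the root commutes with
inversion when arg(-2iz) ≠ π, that is, off the negative imaginary axis. -/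
theorem sqrt_two_mul_I_div {z : ℂ} (hz0 : z ≠ 0) (h : ¬ (z.re = 0 ∧ z.im < 0)) :
    Complex.sqrt (2 * Complex.I / z) = 2 / Complex.sqrt (-2 * Complex.I * z) := by
  have hw0 : -2 * Complex.I * z ≠ 0 := by simp [hz0]
  have harg : (-2 * Complex.I * z).arg ≠ Real.pi := by
    rw [Ne, Complex.arg_eq_pi_iff]
    simpa [and_comm] using h
  rw [show 2 * Complex.I / z = ((4 : ℝ) : ℂ) * (-2 * Complex.I * z)⁻¹ by
    push_cast; field_simp; linear_combination (4 : ℂ) * Complex.I_sq, Complex.sqrt,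
    ofReal_mul_cpow (by norm_num) (inv_ne_zero hw0), Complex.inv_cpow _ _ harg, Complex.sqrt,
    div_eq_mul_inv]
  congr 1
  rw [show (2⁻¹ : ℂ) = ((1 / 2 : ℝ) : ℂ) by push_cast; norm_num,
    ← Complex.ofReal_cpow (by norm_num), ← Real.sqrt_eq_rpow, show (4 : ℝ) = 2 ^ 2 by norm_num,
    Real.sqrt_sq (by norm_num)]
  norm_num

theorem sqrt_zpow (w : ℂ) (k : ℤ) : Complex.sqrt w ^ k = w ^ ((k : ℂ) / 2) := by
  rw [Complex.sqrt, ← Complex.cpow_mul_int, div_eq_mul_inv, mul_comm]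

end

theorem mainTheorem7 (m : ℤ) (z : ℂ) (hz : z ∈ Complex.slitPlane) :
    -- All roots and powers are principal values, off the common cut of `√(2i/z)` and `√(-2iz)`.
    (¬ (z.re = 0 ∧ z.im < 0) →
      sphericalBesselY m z =
        Complex.sqrt (2 * Complex.I / z) * Complex.exp (Complex.I * z) * Complex.I ^ m *
          (-(1 / (Real.pi : ℂ)) *
              (∫ θ in (0 : ℝ)..Real.pi,
                dawson (-Complex.I * Complex.sqrt (-2 * Complex.I * z) * Complex.cos (θ / 2)) *
                  Complex.cos (((m : ℂ) + 1 / 2) * θ)) +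
            Complex.I * (-1) ^ m *
              ∑ j ∈ Finset.Icc (0 : ℤ) m,
                ((2 * m - j).toNat.factorial : ℂ) /
                    ((j.toNat.factorial : ℂ) * ((m - j).toNat.factorial : ℂ)) *
                  (-2 * Complex.I * z) ^ ((j : ℂ) - m - 1 / 2))) ∧
    -- On the whole slit plane, `s` is either value of `√(-2iz)`, with `√(2i/z)` taken to be `2/s`
    -- and `(-2iz)^(j-m-1/2)` taken to be `s^(2j-2m-1)`.
    (∀ s : ℂ, s ^ 2 = -2 * Complex.I * z →
      sphericalBesselY m z =
        (2 / s) * Complex.exp (Complex.I * z) * Complex.I ^ m *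
          (-(1 / (Real.pi : ℂ)) *
              (∫ θ in (0 : ℝ)..Real.pi,
                dawson (-Complex.I * s * Complex.cos (θ / 2)) *
                  Complex.cos (((m : ℂ) + 1 / 2) * θ)) +
            Complex.I * (-1) ^ m *
              ∑ j ∈ Finset.Icc (0 : ℤ) m,
                ((2 * m - j).toNat.factorial : ℂ) /
                    ((j.toNat.factorial : ℂ) * ((m - j).toNat.factorial : ℂ)) *
                  s ^ (2 * j - 2 * m - 1))) := by
  have hz0 := Complex.slitPlane_ne_zero hz
  have hb : ∀ s : ℂ, s ^ 2 = -2 * Complex.I * z →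
      sphericalBesselY m z = sphericalBesselYDawson z s m := fun s hs => by
    have hs0 : s ≠ 0 := by
      rintro rfl
      simp [hz0] at hs
    exact sphericalBesselY_eq m hz (sphericalBesselYDawson_zero hs hs0)
      (sphericalBesselYDawson_neg_one hs hs0) (sphericalBesselYDawson_recurrence hs hs0)
  refine ⟨fun h => ?_, hb⟩
  -- Reading (a) is reading (b) with s the principal root; integer powers of s are principal powers
  -- of -2iz without any branch condition.
  rw [hb (Complex.sqrt (-2 * Complex.I * z)) (by
      rw [← zpow_natCast, sqrt_zpow]; simp),
    sphericalBesselYDawson, sqrt_two_mul_I_div hz0 h, besselPolySum, dawsonCoeff]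
  congr 3
  refine Finset.sum_congr rfl fun j _ => ?_
  rw [sqrt_zpow]
  congr 2
  push_cast
  ring
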